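/- For a finite tree $T$ and $n\ge 0$, let $\mathrm{ex}^c(n,T)$ be the maximum number of edges in an $n$-vertex simple graph $G$ that admits a proper vertex coloring (with any number of colors) such that, in every (not necessarily induced) copy of $T$ in $G$, all leaves of $T$ receive the same color. Here a leaf is a vertex of degree $1$. **Theorem.** Let $T$ be a finite tree with at least one edge such that in the proper vertex $2$-coloring of $T$ (unique up to exchanging the two colors) all leaves have the same color. Then there is $N=N(T)$ such that for all $n\ge N$, $$\mathrm{ex}^c(n,T)=\left\lfloor \frac{n^2}{4}\right\rfloor .$$ Moreover, for these $n$ the maximum is attained by the complete bipartite graph $K_{\lfloor n/2\rfloor,\lceil n/2\rceil}$: it has $\lfloor n^2/4\rfloor$ edges and admits a proper vertex coloring such that in every copy of $T$ in it all leaves of $T$ receive the same color. -/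

import Mathlib

/-- A leaf of a graph is a vertex with exactly one neighbour. -/
def SimpleGraph.IsLeafVertex {V : Type*} (T : SimpleGraph V) (v : V) : Prop :=
  (T.neighborSet v).ncard = 1

/-- All leaves of `T` receive the same color in every copy of `T` in the colored graph `G`
(copies are subgraphs, not necessarily induced). -/
def SimpleGraph.LeavesSameColor {V W α : Type*} (T : SimpleGraph V) (G : SimpleGraph W)
    (c : G.Coloring α) : Prop :=
  ∀ f : SimpleGraph.Copy T G, ∀ u v : V,
    T.IsLeafVertex u → T.IsLeafVertex v → c (f u) = c (f v)

/-- The possible numbers of edges of an `n`-vertex graph that has a proper vertex coloring, with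
any number of colors, such that in every copy of `T` all leaves of `T` have the same color. -/
def SimpleGraph.coloredEdgeCounts {V : Type*} (n : ℕ) (T : SimpleGraph V) : Set ℕ :=
  {m | ∃ (G : SimpleGraph (Fin n)) (c : G.Coloring ℕ),
    T.LeavesSameColor G c ∧ G.edgeSet.ncard = m}

/-- The colored extremal number `ex^c(n, T)`: the maximum of the above edge counts. -/
noncomputable def SimpleGraph.coloredExtremalNumber {V : Type*} (n : ℕ) (T : SimpleGraph V) : ℕ :=
  sSup (T.coloredEdgeCounts n)

/-- The supremum in the definition of `ex^c(n, T)` is always a maximum. -/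
theorem SimpleGraph.isGreatest_coloredExtremalNumber {V : Type*} (n : ℕ) (T : SimpleGraph V) :
    IsGreatest (T.coloredEdgeCounts n) (T.coloredExtremalNumber n) := by
  have hb : BddAbove (T.coloredEdgeCounts n) := by
    refine ⟨(Set.univ : Set (Sym2 (Fin n))).ncard, ?_⟩
    rintro m ⟨G, c, -, rfl⟩
    exact Set.ncard_le_ncard (Set.subset_univ _) Set.finite_univ
  have hne : (T.coloredEdgeCounts n).Nonempty := by
    refine ⟨_, ⊥, SimpleGraph.Coloring.mk (fun _ => 0) (by simp), ?_, rfl⟩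
    intro f u v _ _
    rfl
  exact ⟨Nat.sSup_mem hne hb, fun m hm => le_csSup hb hm⟩

/-!
For the upper bound, let `k` be the number of vertices of `T` and call a coloring good if all
leaves of every copy of `T` have the same color. In a graph of large minimum degree with a good
coloring, embed `T` minus a leaf greedily with the neighbour of that leaf at `p`; every neighbour
of `p` outside this embedding can then serve as the missing leaf, so fewer than `k` neighbours of
`p` avoid some fixed color. Applying this to a vertex `p`, and again to a neighbour of `p` having
its dominant color, yields two colors covering almost all vertices. A vertex `w` of a third color
cannot have `k` neighbours in one of these classes: otherwise embed `T` with one leaf at `w` and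
the rest alternating between the two classes, so that the other leaves land in the class opposite
to the neighbours of `w`. Hence `w` has small degree, a contradiction, and the graph is bipartite.

The minimum degree condition is removed by deleting vertices of degree less than half the order:
each deletion increases the excess of the number of edges over `⌊n ^ 2 / 4⌋`, which therefore
cannot be positive when `n` is large.
-/

namespace ColoredExtremal

open SimpleGraph

section Sets

variable {X : Type*} [Finite X]

theorem natCard_compl_singleton (x : X) : Nat.card ({x}ᶜ : Set X) = Nat.card X - 1 := by
  rw [Nat.card_coe_set_eq, Set.ncard_compl, Set.ncard_singleton]

theorem ncard_le_inter_add_inter_add_compl (s A B : Set X) :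
    s.ncard ≤ (s ∩ A).ncard + (s ∩ B).ncard + (A ∪ B)ᶜ.ncard := by
  calc
    s.ncard ≤ (s ∩ A ∪ s ∩ B ∪ (A ∪ B)ᶜ).ncard := Set.ncard_le_ncard fun x hx => by
      rw [← Set.inter_union_distrib_left]
      by_cases h : x ∈ A ∪ B
      · exact Or.inl ⟨hx, h⟩
      · exact Or.inr h
    _ ≤ (s ∩ A ∪ s ∩ B).ncard + (A ∪ B)ᶜ.ncard := Set.ncard_union_le _ _
    _ ≤ (s ∩ A).ncard + (s ∩ B).ncard + (A ∪ B)ᶜ.ncard := by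
      gcongr
      exact Set.ncard_union_le _ _

theorem card_le_encard_iff {V : Type*} [Finite V] (s : Set X) :
    ENat.card V ≤ s.encard ↔ Nat.card V ≤ s.ncard := by
  rw [ENat.card_eq_coe_natCard, ← s.toFinite.cast_ncard_eq, Nat.cast_le]

end Sets

section Leaves

variable {V W : Type*} {T : SimpleGraph V} {G : SimpleGraph W}

theorem isLeafVertex_iff_degree_eq_one {v : V} [Fintype (T.neighborSet v)] :
    T.IsLeafVertex v ↔ T.degree v = 1 := by
  rw [IsLeafVertex, ← Nat.card_coe_set_eq, Nat.card_eq_fintype_card, card_neighborSet_eq_degree]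

theorem exists_ne_isLeafVertex [Finite V] [Nontrivial V] (hT : T.IsTree) :
    ∃ u v, u ≠ v ∧ T.IsLeafVertex u ∧ T.IsLeafVertex v := by
  classical
  have := Fintype.ofFinite V
  simpa only [isLeafVertex_iff_degree_eq_one] using hT.exists_ne_and_degree_eq_one

theorem isTree_induce_compl_singleton (hT : T.IsTree) {l : V} (hl : T.IsLeafVertex l) :
    (T.induce {l}ᶜ).IsTree := by
  have := (Set.finite_of_ncard_ne_zero (hl.trans_ne one_ne_zero)).fintype
  exact ⟨hT.connected.induce_compl_singleton_of_degree_eq_one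
    (isLeafVertex_iff_degree_eq_one.1 hl), hT.isAcyclic.induce _⟩

theorem exists_neighborSet_eq_singleton {l : V} (hl : T.IsLeafVertex l) :
    ∃ p : ({l}ᶜ : Set V), T.neighborSet l = {↑p} := by
  obtain ⟨p, hp⟩ := Set.ncard_eq_one.1 hl
  have hlp : T.Adj l p := by simp [← mem_neighborSet, hp]
  exact ⟨⟨p, hlp.ne'⟩, hp⟩

theorem exists_copy_extending_of_leaf {l : V} {p : ({l}ᶜ : Set V)} (hp : T.neighborSet l = {↑p})
    (f : Copy (T.induce {l}ᶜ) G) {w : W} (hw : G.Adj (f p) w) (hwf : w ∉ Set.range f) :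
    ∃ g : Copy T G, g l = w ∧ ∀ v : ({l}ᶜ : Set V), g v = f v := by
  classical
  let g : V → W := fun v => if hv : v = l then w else f ⟨v, hv⟩
  have g_leaf : g l = w := dif_pos rfl
  have g_other (v : ({l}ᶜ : Set V)) : g v = f v := dif_neg v.2
  have g_adj_leaf {v : V} (hv : T.Adj l v) : G.Adj (g l) (g v) := by
    obtain rfl : v = p := by rwa [← mem_neighborSet, hp, Set.mem_singleton_iff] at hv
    rw [g_leaf, g_other]
    exact hw.symm
  have hom {u v : V} (huv : T.Adj u v) : G.Adj (g u) (g v) := by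
    by_cases hu : u = l
    · subst hu
      exact g_adj_leaf huv
    by_cases hv : v = l
    · subst hv
      exact (g_adj_leaf huv.symm).symm
    rw [g_other ⟨u, hu⟩, g_other ⟨v, hv⟩]
    exact f.toHom.map_adj (v := ⟨u, hu⟩) (w := ⟨v, hv⟩) huv
  have inj : Function.Injective g := by
    intro u v huv
    by_cases hu : u = l <;> by_cases hv : v = l
    · rw [hu, hv]
    · rw [hu, g_leaf, g_other ⟨v, hv⟩] at huv
      exact (hwf ⟨_, huv.symm⟩).elim
    · rw [hv, g_leaf, g_other ⟨u, hu⟩] at huv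
      exact (hwf ⟨_, huv⟩).elim
    · rw [g_other ⟨u, hu⟩, g_other ⟨v, hv⟩] at huv
      exact congrArg Subtype.val (f.injective huv)
  exact ⟨⟨⟨g, hom⟩, inj⟩, g_leaf, g_other⟩

theorem encard_range_copy_induce_lt [Finite V] {l : V} (f : Copy (T.induce {l}ᶜ) G) :
    (Set.range f).encard < ENat.card V := by
  calc
    (Set.range f).encard ≤ ({l}ᶜ : Set V).encard := by
      rw [← Set.image_univ, ← ENat.card_coe_set_eq {l}ᶜ, ← Set.encard_univ]
      exact Set.encard_image_le f Set.univ
    _ < ENat.card V := (Set.toFinite {l}ᶜ).encard_lt_card (by simp)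

end Leaves

section GreedyEmbedding

variable {W : Type*} {G : SimpleGraph W}

theorem exists_copy_forall_mem {V : Type*} [Finite V] {T : SimpleGraph V} (hT : T.IsTree) (a : V)
    {w : W} (S : V → Set W) (hw : w ∈ S a)
    (hS : ∀ u v, T.Adj u v → v ≠ a → ∀ x ∈ S u, ENat.card V ≤ (G.neighborSet x ∩ S v).encard) :
    ∃ f : Copy T G, f a = w ∧ ∀ v, f v ∈ S v := by
  induction hn : Nat.card V generalizing V with
  | zero => exact absurd hn (Nat.card_pos_iff.2 ⟨⟨a⟩, inferInstance⟩).ne'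
  | succ n ih =>
    rcases subsingleton_or_nontrivial V with _ | _
    · refine ⟨⟨⟨fun _ => w, fun huv => (huv.ne (Subsingleton.elim _ _)).elim⟩,
        Function.injective_of_subsingleton _⟩, rfl, fun v => ?_⟩
      rwa [Subsingleton.elim v a]
    obtain ⟨l, hla, hl⟩ : ∃ l, l ≠ a ∧ T.IsLeafVertex l := by
      obtain ⟨u, v, huv, hu, hv⟩ := exists_ne_isLeafVertex hT
      by_cases hua : u = a
      · exact ⟨v, hua ▸ huv.symm, hv⟩
      · exact ⟨u, hua, hu⟩
    obtain ⟨p, hp⟩ := exists_neighborSet_eq_singleton hl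
    have hpl : T.Adj p l := by simp [adj_comm, ← mem_neighborSet, hp]
    have hcard : Nat.card ({l}ᶜ : Set V) = n := by
      rw [natCard_compl_singleton, hn, Nat.add_sub_cancel]
    obtain ⟨f, hfa, hfS⟩ := ih (isTree_induce_compl_singleton hT hl) ⟨a, hla.symm⟩ (fun v => S v) hw
      (fun u v huv hva x hx => (ENat.card_le_card_of_injective Subtype.val_injective).trans
        (hS u v huv (fun h => hva (Subtype.ext h)) x hx)) hcard
    obtain ⟨x, ⟨hpx, hxS⟩, hxf⟩ : ∃ x ∈ G.neighborSet (f p) ∩ S l, x ∉ Set.range f :=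
      Set.not_subset.1 fun hsub => ((hS p l hpl hla _ (hfS p)).trans
        (Set.encard_le_encard hsub)).not_gt (encard_range_copy_induce_lt f)
    obtain ⟨g, hgl, hg⟩ := exists_copy_extending_of_leaf hp f hpx hxf
    refine ⟨g, (hg ⟨a, hla.symm⟩).trans hfa, fun v => ?_⟩
    by_cases hv : v = l
    · rwa [hv, hgl]
    · exact (hg ⟨v, hv⟩).symm ▸ hfS ⟨v, hv⟩

theorem exists_copy_of_two_classes {V : Type*} [Finite V] {T : SimpleGraph V} (hT : T.IsTree)
    (χ : T.Coloring (Fin 2)) (a : V) {A B : Set W} {w : W}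
    (hw : ENat.card V ≤ (G.neighborSet w ∩ A).encard)
    (hA : ∀ x ∈ A, ENat.card V ≤ (G.neighborSet x ∩ B).encard)
    (hB : ∀ x ∈ B, ENat.card V ≤ (G.neighborSet x ∩ A).encard) :
    ∃ f : Copy T G, f a = w ∧ ∀ v, v ≠ a → χ v = χ a → f v ∈ B := by
  classical
  let S (v : V) : Set W := if v = a then {w} else if χ v = χ a then B else A
  have S_root : S a = {w} := if_pos rfl
  have S_same {v : V} (hv : v ≠ a) (h : χ v = χ a) : S v = B := by simp [S, hv, h]
  have S_diff {v : V} (h : χ v ≠ χ a) : S v = A := by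
    simp [S, h, show v ≠ a from fun hv => h (congrArg χ hv)]
  obtain ⟨f, hfa, hfS⟩ := exists_copy_forall_mem (G := G) hT a (w := w) S (by simp [S_root]) (by
    intro u v huv hva x hx
    have hχ := χ.valid huv
    by_cases hu : χ u = χ a
    · rw [S_diff (hu ▸ hχ.symm)]
      by_cases hua : u = a
      · rw [hua, S_root] at hx
        exact hx ▸ hw
      · exact hB x (S_same hua hu ▸ hx)
    · rw [S_same hva (by omega)]
      exact hA x (S_diff hu ▸ hx))
  exact ⟨f, hfa, fun v hva hv => S_same hva hv ▸ hfS v⟩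

end GreedyEmbedding

section MinimumDegree

theorem disjoint_colorClass {W α : Type*} {G : SimpleGraph W} (c : G.Coloring α) {ρ β : α}
    (h : ρ ≠ β) : Disjoint (c.colorClass ρ) (c.colorClass β) :=
  Set.disjoint_left.2 fun _ hρ hβ => h (hρ.symm.trans hβ)

theorem ncard_neighborSet_le_inter_add_compl {W α : Type*} [Finite W] {G : SimpleGraph W}
    {c : G.Coloring α} {ρ : α} {v : W} (hv : v ∈ c.colorClass ρ) (β : α) :
    (G.neighborSet v).ncard ≤ (G.neighborSet v ∩ c.colorClass β).ncard +
      (c.colorClass ρ ∪ c.colorClass β)ᶜ.ncard := by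
  have hempty : G.neighborSet v ∩ c.colorClass ρ = ∅ :=
    Set.eq_empty_of_forall_notMem fun u ⟨hvu, hu⟩ => c.valid hvu (hv.trans hu.symm)
  simpa only [hempty, Set.ncard_empty, zero_add] using
    ncard_le_inter_add_inter_add_compl (G.neighborSet v) (c.colorClass ρ) (c.colorClass β)

variable {V W α : Type*} [Finite V] [Nontrivial V] {T : SimpleGraph V} {G : SimpleGraph W}
  {c : G.Coloring α} {δ : ℕ}

theorem exists_encard_neighborSet_diff_colorClass_lt (hc : T.LeavesSameColor G c) (hT : T.IsTree)
    (hdeg : ∀ w, ENat.card V ≤ (G.neighborSet w).encard) (p : W) :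
    ∃ κ, (G.neighborSet p \ c.colorClass κ).encard < ENat.card V := by
  obtain ⟨x, y, hxy, hx, hy⟩ := exists_ne_isLeafVertex hT
  obtain ⟨z, hz⟩ := exists_neighborSet_eq_singleton hy
  obtain ⟨f, hfz, -⟩ := exists_copy_forall_mem (G := G) (isTree_induce_compl_singleton hT hy) z
    (fun _ => Set.univ) (Set.mem_univ p) (fun _ _ _ _ w _ => by
      rw [Set.inter_univ]
      exact (ENat.card_le_card_of_injective Subtype.val_injective).trans (hdeg w))
  have hsub : G.neighborSet p \ c.colorClass (c (f ⟨x, hxy⟩)) ⊆ Set.range f := by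
    rintro w ⟨hpw, hwx⟩
    by_contra hwf
    obtain ⟨g, hgy, hg⟩ := exists_copy_extending_of_leaf hz f (hfz.symm ▸ hpw) hwf
    have hyx := hc g y x hy hx
    rw [hgy, hg ⟨x, hxy⟩] at hyx
    exact hwx hyx
  exact ⟨_, (Set.encard_le_encard hsub).trans_lt (encard_range_copy_induce_lt f)⟩

theorem encard_neighborSet_inter_colorClass_lt (hc : T.LeavesSameColor G c) (hT : T.IsTree)
    (χ : T.Coloring (Fin 2))
    (hχ : ∀ u v : V, T.IsLeafVertex u → T.IsLeafVertex v → χ u = χ v) {ρ β : α}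
    (hρ : ∀ v ∈ c.colorClass ρ, ENat.card V ≤ (G.neighborSet v ∩ c.colorClass β).encard)
    (hβ : ∀ v ∈ c.colorClass β, ENat.card V ≤ (G.neighborSet v ∩ c.colorClass ρ).encard)
    {w : W} (hw : c w ≠ β) :
    (G.neighborSet w ∩ c.colorClass ρ).encard < ENat.card V := by
  by_contra! hlarge
  obtain ⟨x, y, hxy, hx, hy⟩ := exists_ne_isLeafVertex hT
  obtain ⟨f, hfy, hf⟩ := exists_copy_of_two_classes hT χ y hlarge hρ hβ
  have hfx : c (f x) = β := hf x hxy (hχ x y hx hy)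
  exact hw (by rw [← hfy, hc f y x hy hx, hfx])

variable [Finite W]

theorem exists_lt_ncard_neighborSet_inter_colorClass (hc : T.LeavesSameColor G c) (hT : T.IsTree)
    (hδ : ∀ w, δ ≤ (G.neighborSet w).ncard) (hV : Nat.card V ≤ δ) (p : W) :
    ∃ κ, δ < (G.neighborSet p ∩ c.colorClass κ).ncard + Nat.card V := by
  obtain ⟨κ, hκ⟩ := exists_encard_neighborSet_diff_colorClass_lt hc hT
    (fun w => (card_le_encard_iff _).2 (hV.trans (hδ w))) p
  rw [← not_le, card_le_encard_iff] at hκ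
  have hsplit := Set.ncard_inter_add_ncard_sdiff_eq_ncard (G.neighborSet p) (c.colorClass κ)
  have hp := hδ p
  exact ⟨κ, by omega⟩

theorem exists_two_colors_ncard_compl_le [Nonempty W] (hc : T.LeavesSameColor G c) (hT : T.IsTree)
    (hδ : ∀ w, δ ≤ (G.neighborSet w).ncard) (hV : Nat.card V ≤ δ) :
    ∃ ρ β, ρ ≠ β ∧
      (c.colorClass ρ ∪ c.colorClass β)ᶜ.ncard + 2 * δ ≤ Nat.card W + 2 * Nat.card V := by
  have dominant := exists_lt_ncard_neighborSet_inter_colorClass hc hT hδ hV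
  have exists_mem {p : W} {κ : α} (h : δ < (G.neighborSet p ∩ c.colorClass κ).ncard + Nat.card V) :
      (G.neighborSet p ∩ c.colorClass κ).Nonempty :=
    Set.nonempty_of_ncard_ne_zero (by omega)
  obtain ⟨p⟩ := ‹Nonempty W›
  obtain ⟨ρ, hρ⟩ := dominant p
  obtain ⟨r, -, hr⟩ := exists_mem hρ
  obtain ⟨β, hβ⟩ := dominant r
  obtain ⟨b, hrb, hb⟩ := exists_mem hβ
  have hne : ρ ≠ β := fun h => c.valid hrb (hr.trans (h.trans hb.symm))
  have hρ_le := Set.ncard_le_ncard (Set.inter_subset_right (s := G.neighborSet p)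
    (t := c.colorClass ρ))
  have hβ_le := Set.ncard_le_ncard (Set.inter_subset_right (s := G.neighborSet r)
    (t := c.colorClass β))
  have hunion := Set.ncard_union_eq (disjoint_colorClass c hne)
  have hcompl := Set.ncard_add_ncard_compl (c.colorClass ρ ∪ c.colorClass β)
  exact ⟨ρ, β, hne, by omega⟩

theorem isBipartite_of_leavesSameColor (hc : T.LeavesSameColor G c) (hT : T.IsTree)
    (χ : T.Coloring (Fin 2))
    (hχ : ∀ u v : V, T.IsLeafVertex u → T.IsLeafVertex v → χ u = χ v)
    (hδ : ∀ w, δ ≤ (G.neighborSet w).ncard) (hV : Nat.card W + 4 * Nat.card V ≤ 3 * δ) :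
    G.IsBipartite := by
  rcases isEmpty_or_nonempty W with _ | _
  · exact Colorable.of_isEmpty 2
  obtain ⟨ρ, β, hne, hfew⟩ := exists_two_colors_ncard_compl_le hc hT hδ (by omega)
  have large_ρ (v) (hv : v ∈ c.colorClass ρ) :
      ENat.card V ≤ (G.neighborSet v ∩ c.colorClass β).encard := by
    have hsum := ncard_neighborSet_le_inter_add_compl hv β
    have hdeg := hδ v
    rw [card_le_encard_iff]
    omega
  have large_β (v) (hv : v ∈ c.colorClass β) :
      ENat.card V ≤ (G.neighborSet v ∩ c.colorClass ρ).encard := by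
    have hsum := ncard_neighborSet_le_inter_add_compl hv ρ
    rw [Set.union_comm] at hsum
    have hdeg := hδ v
    rw [card_le_encard_iff]
    omega
  have covered (w : W) : c w = ρ ∨ c w = β := by
    by_contra! hw
    have small_ρ := encard_neighborSet_inter_colorClass_lt hc hT χ hχ large_ρ large_β hw.2
    have small_β := encard_neighborSet_inter_colorClass_lt hc hT χ hχ large_β large_ρ hw.1
    rw [← not_le, card_le_encard_iff] at small_ρ small_β
    have hsum := ncard_le_inter_add_inter_add_compl (G.neighborSet w) (c.colorClass ρ)
      (c.colorClass β)
    have hdeg := hδ w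
    omega
  refine IsBipartiteWith.isBipartite (s := c.colorClass ρ) (t := c.colorClass β)
    ⟨disjoint_colorClass c hne, fun u v huv => ?_⟩
  have hvalid := c.valid huv
  have hu := covered u
  have hv := covered v
  simp only [Coloring.colorClass, Set.mem_ofPred_eq]
  grind

end MinimumDegree

section EdgeCount

universe u

variable {W : Type u} [Finite W]

theorem ncard_edgeSet_le_of_isBipartite {G : SimpleGraph W} (h : G.IsBipartite) :
    G.edgeSet.ncard ≤ Nat.card W ^ 2 / 4 := by
  have h4 := h.four_mul_encard_edgeSet_le
  rw [ENat.card_eq_coe_natCard, ← (Set.toFinite G.edgeSet).cast_ncard_eq] at h4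
  have : 4 * G.edgeSet.ncard ≤ Nat.card W ^ 2 := by exact_mod_cast h4
  omega

theorem ncard_edgeSet_le_choose_two (G : SimpleGraph W) :
    G.edgeSet.ncard ≤ (Nat.card W).choose 2 := by
  classical
  have := Fintype.ofFinite W
  rw [← coe_edgeFinset, Set.ncard_coe_finset, Nat.card_eq_fintype_card]
  exact G.card_edgeFinset_le_card_choose_two

theorem ncard_edgeSet_induce_compl_singleton (G : SimpleGraph W) (w : W) :
    (G.induce {w}ᶜ).edgeSet.ncard = G.edgeSet.ncard - (G.neighborSet w).ncard := by
  classical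
  have := Fintype.ofFinite W
  rw [← coe_edgeFinset, ← coe_edgeFinset, Set.ncard_coe_finset, Set.ncard_coe_finset,
    card_edgeFinset_induce_compl_singleton, card_edgeFinset_deleteIncidenceSet,
    ← card_neighborSet_eq_degree, ← Nat.card_eq_fintype_card, Nat.card_coe_set_eq]

theorem succ_sq_div_four (n : ℕ) : (n + 1) ^ 2 / 4 = n ^ 2 / 4 + (n + 1) / 2 := by
  obtain ⟨k, rfl | rfl⟩ := n.even_or_odd' <;> ring_nf <;> omega

theorem ncard_edgeSet_le_add_of_minDegree {P : ∀ {W : Type u}, SimpleGraph W → Prop} {m : ℕ}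
    (hP : ∀ {W : Type u} {G : SimpleGraph W} (w : W), P G → P (G.induce {w}ᶜ))
    (hm : ∀ {W : Type u} [Finite W] {G : SimpleGraph W}, P G → m ≤ Nat.card W →
      (∀ w, Nat.card W / 2 ≤ (G.neighborSet w).ncard) → G.edgeSet.ncard ≤ Nat.card W ^ 2 / 4)
    {G : SimpleGraph W} (hG : P G) :
    G.edgeSet.ncard ≤ Nat.card W ^ 2 / 4 + ((m + 1).choose 2 - Nat.card W) := by
  induction hn : Nat.card W generalizing W with
  | zero =>
    have hedges := ncard_edgeSet_le_choose_two G
    rw [hn, Nat.choose_zero_succ] at hedges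
    omega
  | succ n ih =>
    by_cases hnm : n + 1 ≤ m
    · have hedges := ncard_edgeSet_le_choose_two G
      have hchoose : (n + 1 + 1).choose 2 ≤ (m + 1).choose 2 :=
        Nat.choose_le_choose 2 (by omega)
      have hpascal : (n + 1 + 1).choose 2 = (n + 1) + (n + 1).choose 2 := by
        rw [Nat.choose_succ_succ', Nat.choose_one_right]
      rw [hn] at hedges
      omega
    by_cases hdeg : ∀ w, Nat.card W / 2 ≤ (G.neighborSet w).ncard
    · have := hm hG (by omega) hdeg
      rw [hn] at this
      omega
    push Not at hdeg
    obtain ⟨w, hw⟩ := hdeg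
    have hcard : Nat.card ({w}ᶜ : Set W) = n := by
      rw [natCard_compl_singleton, hn, Nat.add_sub_cancel]
    have hdelete := ih (hP w hG) hcard
    rw [ncard_edgeSet_induce_compl_singleton] at hdelete
    rw [hn] at hw
    rw [succ_sq_div_four]
    omega

end EdgeCount

section Extremal

variable {V W α : Type*} {T : SimpleGraph V} {G : SimpleGraph W}

theorem leavesSameColor_comp_embedding {W' : Type*} {G' : SimpleGraph W'} {c : G.Coloring α}
    (hc : T.LeavesSameColor G c) (e : G' ↪g G) : T.LeavesSameColor G' (c.comp e.toHom) :=
  fun f => hc (e.toCopy.comp f)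

theorem ncard_edgeSet_le_of_leavesSameColor [Finite V] [Nontrivial V] [Finite W]
    {c : G.Coloring α} (hc : T.LeavesSameColor G c) (hT : T.IsTree) (χ : T.Coloring (Fin 2))
    (hχ : ∀ u v : V, T.IsLeafVertex u → T.IsLeafVertex v → χ u = χ v)
    (hW : (8 * Nat.card V + 4).choose 2 ≤ Nat.card W) :
    G.edgeSet.ncard ≤ Nat.card W ^ 2 / 4 := by
  have h := ncard_edgeSet_le_add_of_minDegree (m := 8 * Nat.card V + 3)
    (P := fun {W} G => ∃ c : G.Coloring α, T.LeavesSameColor G c)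
    (fun w ⟨_, hc⟩ => ⟨_, leavesSameColor_comp_embedding hc (Embedding.induce {w}ᶜ)⟩)
    (fun ⟨_, hc⟩ hm hdeg => ncard_edgeSet_le_of_isBipartite
      (isBipartite_of_leavesSameColor hc hT χ hχ hdeg (by omega))) ⟨c, hc⟩
  rwa [Nat.sub_eq_zero_of_le hW, add_zero] at h

theorem ncard_edgeSet_mem_coloredEdgeCounts {n : ℕ} (hn : Nat.card W = n) [Finite W]
    {c : G.Coloring ℕ} (hc : T.LeavesSameColor G c) :
    G.edgeSet.ncard ∈ T.coloredEdgeCounts n := by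
  obtain ⟨φ⟩ : Nonempty (W ≃ Fin n) := ⟨Finite.equivFinOfCardEq hn⟩
  let e : G ≃g G.map φ.toEmbedding := Iso.map φ G
  refine ⟨_, _, leavesSameColor_comp_embedding hc e.symm.toEmbedding, ?_⟩
  rw [← Nat.card_coe_set_eq, ← Nat.card_coe_set_eq]
  exact (Nat.card_congr e.mapEdgeSet).symm

theorem coloring_eq_iff_coloring_eq (χ χ' : T.Coloring Bool) {u v : V} (h : T.Reachable u v) :
    χ u = χ v ↔ χ' u = χ' v := by
  obtain ⟨p⟩ := h
  rw [Bool.eq_iff_iff (a := χ u), Bool.eq_iff_iff (a := χ' u), ← χ.even_length_iff_congr p,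
    ← χ'.even_length_iff_congr p]

theorem exists_leavesSameColor_completeBipartiteGraph (hT : T.Preconnected)
    (χ : T.Coloring (Fin 2))
    (hχ : ∀ u v : V, T.IsLeafVertex u → T.IsLeafVertex v → χ u = χ v) (A B : Type*) :
    ∃ c : (completeBipartiteGraph A B).Coloring ℕ,
      T.LeavesSameColor (completeBipartiteGraph A B) c := by
  let c := CompleteBipartiteGraph.bicoloring A B
  have hc : T.LeavesSameColor (completeBipartiteGraph A B) c := fun f u v hu hv =>
    (coloring_eq_iff_coloring_eq (recolorOfEquiv T finTwoEquiv χ) (c.comp f.toHom) (hT u v)).1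
      (congrArg finTwoEquiv (hχ u v hu hv))
  exact ⟨recolorOfEmbedding _ ⟨Bool.toNat, by decide⟩ c,
    fun f u v hu hv => congrArg Bool.toNat (hc f u v hu hv)⟩

theorem ncard_edgeSet_completeBipartiteGraph (A B : Type*) :
    (completeBipartiteGraph A B).edgeSet.ncard = Nat.card A * Nat.card B := by
  rw [Set.ncard, encard_edgeSet_completeBipartiteGraph, ENat.toNat_mul]
  rfl

theorem half_mul_succ_half (n : ℕ) : n / 2 * ((n + 1) / 2) = n ^ 2 / 4 := by
  obtain ⟨k, rfl | rfl⟩ := n.even_or_odd'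
  · rw [show 2 * k / 2 = k by omega, show (2 * k + 1) / 2 = k by omega]
    ring_nf
    omega
  · rw [show (2 * k + 1) / 2 = k by omega, show (2 * k + 1 + 1) / 2 = k + 1 by omega]
    ring_nf
    omega

theorem ceil_half (n : ℕ) : ⌈(n : ℝ) / 2⌉₊ = (n + 1) / 2 := by
  obtain ⟨k, rfl | rfl⟩ := n.even_or_odd'
  · rw [show (2 * k + 1) / 2 = k by omega]
    simp
  · rw [show (2 * k + 1 + 1) / 2 = k + 1 by omega, Nat.ceil_eq_iff k.succ_ne_zero]
    push_cast
    constructor <;> linarith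

end Extremal

end ColoredExtremal

open ColoredExtremal SimpleGraph in
theorem mainTheorem3 {V : Type*} [Finite V] [Nontrivial V] (T : SimpleGraph V) (hT : T.IsTree)
    (χ : T.Coloring (Fin 2))
    (hχ : ∀ u v : V, T.IsLeafVertex u → T.IsLeafVertex v → χ u = χ v) :
    ∃ N : ℕ, ∀ n : ℕ, N ≤ n →
      T.coloredExtremalNumber n = ⌊(n : ℝ) ^ 2 / 4⌋₊ ∧
      (∃ c : (completeBipartiteGraph (Fin ⌊(n : ℝ) / 2⌋₊) (Fin ⌈(n : ℝ) / 2⌉₊)).Coloring ℕ,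
        T.LeavesSameColor
          (completeBipartiteGraph (Fin ⌊(n : ℝ) / 2⌋₊) (Fin ⌈(n : ℝ) / 2⌉₊)) c) ∧
      (completeBipartiteGraph (Fin ⌊(n : ℝ) / 2⌋₊) (Fin ⌈(n : ℝ) / 2⌉₊)).edgeSet.ncard =
        ⌊(n : ℝ) ^ 2 / 4⌋₊ := by
  refine ⟨(8 * Nat.card V + 4).choose 2, fun n hn => ?_⟩
  rw [ceil_half, Nat.floor_div_ofNat, Nat.floor_div_ofNat, ← Nat.cast_pow, Nat.floor_natCast,
    Nat.floor_natCast]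
  obtain ⟨c, hc⟩ := exists_leavesSameColor_completeBipartiteGraph hT.preconnected χ hχ
    (Fin (n / 2)) (Fin ((n + 1) / 2))
  have hedges : (completeBipartiteGraph (Fin (n / 2)) (Fin ((n + 1) / 2))).edgeSet.ncard =
      n ^ 2 / 4 := by
    rw [ncard_edgeSet_completeBipartiteGraph, Nat.card_fin, Nat.card_fin, half_mul_succ_half]
  refine ⟨le_antisymm ?_ ?_, ⟨c, hc⟩, hedges⟩
  · obtain ⟨G, c, hc, hG⟩ := (isGreatest_coloredExtremalNumber n T).1
    rw [← hG]
    simpa using ncard_edgeSet_le_of_leavesSameColor hc hT χ hχ (by simpa using hn)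
  · rw [← hedges]
    exact (isGreatest_coloredExtremalNumber n T).2
      (ncard_edgeSet_mem_coloredEdgeCounts (by simp; omega) hc)
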